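/- \textbf{Theorem (Separability of optimal sensing and control design).} Let $T\ge 0$ and $k\ge 0$ be integers and let $\mathcal V$ be a finite set of sensors. Consider the linear system $$x_{t+1}=A_tx_t+B_tu_t+w_t,\qquad y_{i,t}=C_{i,t}x_t+v_{i,t}\quad(i\in\mathcal V),\qquad t=1,\dots,T,$$ with real matrices of compatible (possibly time-varying) sizes, where $x_1$ is Gaussian with arbitrary mean and positive semidefinite covariance $\Sigma_{1|0}$, $w_t$ is Gaussian with mean zero and positive semidefinite covariance $W_t$, $v_{i,t}$ is Gaussian with mean zero and positive definite covariance $V_{i,t}$, and all the vectors $x_1,w_t,v_{i,t}$ $(1\le t\le T,\ i\in\mathcal V)$ are mutually independent. For $\mathcal S\subseteq\mathcal V$ let $y_t(\mathcal S)=(y_{i,t})_{i\in\mathcal S}$. An admissible policy for $\mathcal S$ is a sequence of measurable feedback laws $u_t=u_t(y_1(\mathcal S),\dots,y_t(\mathcal S))$, $t=1,\dots,T$. Let $Q_t$ be positive semidefinite and $R_t$ positive definite, write $\|z\|_M^2=z^{\mathsf T}Mz$, and let $$h[\mathcal S,u_{1:T}]=\sum_{t=1}^T\mathbb E\big[\|x_{t+1}\|_{Q_t}^2+\|u_t\|_{R_t}^2\big]\in[0,\infty].$$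 The sensing-constrained LQG problem is to minimise $h[\mathcal S,u_{1:T}]$ over all $\mathcal S\subseteq\mathcal V$ with $|\mathcal S|\le k$ and all admissible policies $u_{1:T}$ for $\mathcal S$. Define matrices, which do not depend on any sensor set, by the backward recursion with $N_{T+1}=0$ and, for $t=T,\dots,1$, $$S_t=Q_t+N_{t+1},\quad N_t=A_t^{\mathsf T}(S_t^{-1}+B_tR_t^{-1}B_t^{\mathsf T})^{-1}A_t,\quad M_t=B_t^{\mathsf T}S_tB_t+R_t,\quad K_t=-M_t^{-1}B_t^{\mathsf T}S_tA_t,\quad \Theta_t=K_t^{\mathsf T}M_tK_t,$$ where for singular $S_t$ the matrix $(S_t^{-1}+B_tR_t^{-1}B_t^{\mathsf T})^{-1}$ is read as $(I+S_tB_tR_t^{-1}B_t^{\mathsf T})^{-1}S_t$ (the two agree when $S_t$ is invertible). For $\mathcal S\subseteq\mathcal V$ let $\hat x_{t,\mathcal S}=\mathbb E(x_t\mid y_1(\mathcal S),\dots,y_t(\mathcal S))$ be the Kalman estimator and $\Sigma_{t|t}(\mathcal S)=\mathbb E[(\hat x_{t,\mathcal S}-x_t)(\hat x_{t,\mathcal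 S}-x_t)^{\mathsf T}]$ its error covariance, evaluated for $u\equiv0$. Then: (a) $\Sigma_{t|t}(\mathcal S)$ depends only on $\mathcal S$: under every admissible policy of finite cost for $\mathcal S$ the error covariance of the estimator has this same value, for $t=1,\dots,T$. (b) For every $\mathcal S\subseteq\mathcal V$ there is an admissible policy for $\mathcal S$ with $u_t=K_t\hat x_{t,\mathcal S}$ almost surely for $t=1,\dots,T$; an admissible policy minimises $h[\mathcal S,\cdot]$ among the admissible policies for $\mathcal S$ if and only if it has this property; and the minimum is $$g(\mathcal S)=\mathbb E\|x_1\|_{N_1}^2+\sum_{t=1}^T\big(\operatorname{tr}[\Theta_t\Sigma_{t|t}(\mathcal S)]+\operatorname{tr}[W_tS_t]\big).$$ (c) The sensing-constrained LQG problem has a solution, and a sensor set $\mathcal S^\star\subseteq\mathcal V$ together with an admissible policy $u^\star_{1:T}$ for $\mathcal S^\star$ is a solution if and only if $$\mathcal S^\star\in\operatorname*{arg\,min}_{\mathcal S\subseteq\mathcal V,\ |\mathcal S|\le k}\ \sum_{t=1}^T\operatorname{tr}[\Theta_t\Sigma_{t|t}(\mathcal S)]\qquad\text{and}\qquad u_t^\star=K_t\hat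 x_{t,\mathcal S^\star}\ \text{ almost surely},\quad t=1,\dots,T.$$ -/

import Mathlib

open MeasureTheory ProbabilityTheory Matrix
open scoped ENNReal

/-- `‖x‖²_P = xᵀ P x`. -/
def quadForm {d : ℕ} (P : Matrix (Fin d) (Fin d) ℝ) (x : EuclideanSpace ℝ (Fin d)) : ℝ :=
  x.ofLp ⬝ᵥ (P *ᵥ x.ofLp)

/-- Data of a finite-horizon LQG problem with a set `V` of available sensors.
Times are counted from `0`: the index `t` here is time `t + 1` of the usual convention, so that
the initial state is `x₀`, the controls, measurements and noises live at times `t < T`, and the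
last state is `x_T`. All dimensions may vary with time (and with the sensor). Entries at times
outside the horizon are irrelevant. -/
structure LQGData (V : Type*) where
  /-- time horizon -/
  T : ℕ
  /-- state dimensions -/
  n : ℕ → ℕ
  /-- control dimensions -/
  m : ℕ → ℕ
  /-- measurement dimensions -/
  p : V → ℕ → ℕ
  /-- system matrices -/
  A : (t : ℕ) → Matrix (Fin (n (t + 1))) (Fin (n t)) ℝ
  /-- input matrices -/
  B : (t : ℕ) → Matrix (Fin (n (t + 1))) (Fin (m t)) ℝ
  /-- measurement matrices -/
  C : (i : V) → (t : ℕ) → Matrix (Fin (p i t)) (Fin (n t)) ℝ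
  /-- state-cost matrices; `Q t` weights the state at time `t + 1` -/
  Q : (t : ℕ) → Matrix (Fin (n (t + 1))) (Fin (n (t + 1))) ℝ
  /-- control-cost matrices -/
  R : (t : ℕ) → Matrix (Fin (m t)) (Fin (m t)) ℝ
  /-- mean of the initial state -/
  mean₀ : EuclideanSpace ℝ (Fin (n 0))
  /-- covariance of the initial state -/
  cov₀ : Matrix (Fin (n 0)) (Fin (n 0)) ℝ
  /-- process noise covariances -/
  covW : (t : ℕ) → Matrix (Fin (n (t + 1))) (Fin (n (t + 1))) ℝ
  /-- measurement noise covariances -/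
  covV : (i : V) → (t : ℕ) → Matrix (Fin (p i t)) (Fin (p i t)) ℝ
  Q_posSemidef : ∀ t < T, (Q t).PosSemidef
  R_posDef : ∀ t < T, (R t).PosDef
  cov₀_posSemidef : cov₀.PosSemidef
  covW_posSemidef : ∀ t < T, (covW t).PosSemidef
  covV_posDef : ∀ i, ∀ t < T, (covV i t).PosDef

namespace LQGData

variable {V : Type*} (D : LQGData V)

/-! ### Backward Riccati recursion -/

/-- `N t = Aᵀ (S⁻¹ + B R⁻¹ Bᵀ)⁻¹ A` with `S = Q t + N (t + 1)`, and `N T = 0`. The inner inverse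
is written `(1 + S B R⁻¹ Bᵀ)⁻¹ S`, which is the same matrix when `S` is invertible and its
continuous extension when `S` is only positive semidefinite. -/
noncomputable def riccatiN (t : ℕ) : Matrix (Fin (D.n t)) (Fin (D.n t)) ℝ :=
  if t < D.T then
    (D.A t)ᵀ *
      ((1 + (D.Q t + riccatiN (t + 1)) * D.B t * (D.R t)⁻¹ * (D.B t)ᵀ)⁻¹ *
        (D.Q t + riccatiN (t + 1))) * D.A t
  else 0
termination_by D.T - t

/-- `S t = Q t + N (t + 1)`. -/
noncomputable def riccatiS (t : ℕ) : Matrix (Fin (D.n (t + 1))) (Fin (D.n (t + 1))) ℝ :=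
  D.Q t + D.riccatiN (t + 1)

/-- `M t = Bᵀ S B + R`. -/
noncomputable def riccatiM (t : ℕ) : Matrix (Fin (D.m t)) (Fin (D.m t)) ℝ :=
  (D.B t)ᵀ * D.riccatiS t * D.B t + D.R t

/-- `K t = - M⁻¹ Bᵀ S A`. -/
noncomputable def gainK (t : ℕ) : Matrix (Fin (D.m t)) (Fin (D.n t)) ℝ :=
  -((D.riccatiM t)⁻¹ * (D.B t)ᵀ * D.riccatiS t * D.A t)

/-- `Θ t = Kᵀ M K`. -/
noncomputable def theta (t : ℕ) : Matrix (Fin (D.n t)) (Fin (D.n t)) ℝ :=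
  (D.gainK t)ᵀ * D.riccatiM t * D.gainK t

/-! ### Control policies -/

/-- Measurements collected by the sensors in `S` at the times `0, …, t`. -/
abbrev History (S : Finset V) (t : ℕ) : Type _ :=
  (s : Fin (t + 1)) → (i : S) → EuclideanSpace ℝ (Fin (D.p i s))

/-- A control policy informed by the active sensor set `S`: the control at time `t` is a function
of the measurements of the active sensors up to time `t`. -/
abbrev Policy (S : Finset V) : Type _ :=
  (t : ℕ) → D.History S t → EuclideanSpace ℝ (Fin (D.m t))

variable {D} in
/-- Admissible policies: those that are (Borel) measurable. -/
def Admissible {S : Finset V} (π : D.Policy S) : Prop :=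
  ∀ t < D.T, Measurable (π t)

/-- The policy that applies no control. -/
def zeroPolicy (S : Finset V) : D.Policy S := fun _ _ => 0

/-- The initial state, the process noises and the measurement noises: jointly independent Gaussian
vectors on a probability space, with the prescribed means and covariances. -/
structure Randomness {Ω : Type*} [MeasurableSpace Ω] (μ : Measure Ω) where
  x₀ : Ω → EuclideanSpace ℝ (Fin (D.n 0))
  w : (t : ℕ) → Ω → EuclideanSpace ℝ (Fin (D.n (t + 1)))
  v : (i : V) → (t : ℕ) → Ω → EuclideanSpace ℝ (Fin (D.p i t))
  measurable_x₀ : Measurable x₀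
  measurable_w : ∀ t < D.T, Measurable (w t)
  measurable_v : ∀ i, ∀ t < D.T, Measurable (v i t)
  law_x₀ : μ.map x₀ = multivariateGaussian D.mean₀ D.cov₀
  law_w : ∀ t < D.T, μ.map (w t) = multivariateGaussian 0 (D.covW t)
  law_v : ∀ i, ∀ t < D.T, μ.map (v i t) = multivariateGaussian 0 (D.covV i t)
  indep : iIndep
    (Sum.elim (fun _ : Unit => MeasurableSpace.comap x₀ inferInstance)
      (Sum.elim (fun t : Fin D.T => MeasurableSpace.comap (w t) inferInstance)
        (fun it : V × Fin D.T => MeasurableSpace.comap (v it.1 it.2) inferInstance))) μ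

namespace Randomness

variable {D} {Ω : Type*} [MeasurableSpace Ω] {μ : Measure Ω} (X : D.Randomness μ)

/-- Closed-loop state under a policy `π` informed by `S`:
`x_{t+1} = A_t x_t + B_t u_t + w_t`, `u_t = π_t (y_0, …, y_t)`, `y_{i,s} = C_{i,s} x_s + v_{i,s}`. -/
noncomputable def state {S : Finset V} (π : D.Policy S) :
    (t : ℕ) → Ω → EuclideanSpace ℝ (Fin (D.n t))
  | 0, ω => X.x₀ ω
  | t + 1, ω =>
      toEuclideanLin (D.A t) (state π t ω) +
        toEuclideanLin (D.B t)
          (π t fun (s : Fin (t + 1)) (i : S) =>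
            toEuclideanLin (D.C i s) (state π s ω) + X.v i s ω) +
        X.w t ω
termination_by t => t
decreasing_by
  · omega
  · exact s.isLt

/-- Closed-loop measurements of the active sensors up to time `t`. -/
noncomputable def history {S : Finset V} (π : D.Policy S) (t : ℕ) (ω : Ω) : D.History S t :=
  fun s i => toEuclideanLin (D.C i s) (X.state π s ω) + X.v i s ω

/-- Closed-loop control `u_t`. -/
noncomputable def control {S : Finset V} (π : D.Policy S) (t : ℕ) (ω : Ω) :
    EuclideanSpace ℝ (Fin (D.m t)) :=
  π t (X.history π t ω)

/-- The σ-algebra generated by the measurements of the active sensors up to time `t`. -/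
@[reducible]
noncomputable def info {S : Finset V} (π : D.Policy S) (t : ℕ) : MeasurableSpace Ω :=
  MeasurableSpace.comap (X.history π t) inferInstance

/-- The estimator `x̂_t = 𝔼[x_t | y_0, …, y_t]`. -/
noncomputable def estimate {S : Finset V} (π : D.Policy S) (t : ℕ) :
    Ω → EuclideanSpace ℝ (Fin (D.n t)) :=
  μ[X.state π t | X.info π t]

/-- Error covariance `𝔼[(x̂_t - x_t)(x̂_t - x_t)ᵀ]` of the estimator under the policy `π`. -/
noncomputable def errorCovOf {S : Finset V} (π : D.Policy S) (t : ℕ) :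
    Matrix (Fin (D.n t)) (Fin (D.n t)) ℝ :=
  Matrix.of fun a b =>
    ∫ ω, (X.estimate π t ω a - X.state π t ω a) * (X.estimate π t ω b - X.state π t ω b) ∂μ

/-- Error covariance `Σ_{t|t}(S)` of the sensor set `S`, evaluated on the uncontrolled system. -/
noncomputable def errorCov (S : Finset V) (t : ℕ) : Matrix (Fin (D.n t)) (Fin (D.n t)) ℝ :=
  X.errorCovOf (D.zeroPolicy S) t

/-- The LQG cost `h[S, u] = ∑ t, 𝔼[‖x_{t+1}‖²_{Q_t} + ‖u_t‖²_{R_t}]`, with values in `[0, ∞]`. -/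
noncomputable def cost {S : Finset V} (π : D.Policy S) : ℝ≥0∞ :=
  ∑ t ∈ Finset.range D.T,
    ∫⁻ ω, ENNReal.ofReal
      (quadForm (D.Q t) (X.state π (t + 1) ω) + quadForm (D.R t) (X.control π t ω)) ∂μ

/-- `(S, π)` solves the sensing-constrained LQG problem with at most `k` active sensors. -/
def IsSolution (k : ℕ) (S : Finset V) (π : D.Policy S) : Prop :=
  S.card ≤ k ∧ Admissible π ∧
    ∀ (S' : Finset V) (π' : D.Policy S'), S'.card ≤ k → Admissible π' → X.cost π ≤ X.cost π'

/-- `π` is an optimal admissible policy for the fixed active sensor set `S`. -/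
def IsOptimalPolicy {S : Finset V} (π : D.Policy S) : Prop :=
  Admissible π ∧ ∀ π' : D.Policy S, Admissible π' → X.cost π ≤ X.cost π'

/-- The sensing objective `∑ t, tr(Θ_t Σ_{t|t}(S))`. -/
noncomputable def sensingCost (S : Finset V) : ℝ :=
  ∑ t ∈ Finset.range D.T, (D.theta t * X.errorCov S t).trace

/-- `S` minimises the sensing objective over the sensor sets of cardinality at most `k`. -/
def IsOptimalSensorSet (k : ℕ) (S : Finset V) : Prop :=
  S.card ≤ k ∧ ∀ S' : Finset V, S'.card ≤ k → X.sensingCost S ≤ X.sensingCost S'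

/-- Almost surely, the closed-loop controls are `u_t = K_t x̂_t` at all times of the horizon. -/
def IsCertaintyEquivalent {S : Finset V} (π : D.Policy S) : Prop :=
  ∀ t < D.T, ∀ᵐ ω ∂μ, X.control π t ω = toEuclideanLin (D.gainK t) (X.estimate π t ω)

end Randomness

end LQGData

/-!
The argument rests on two facts, neither of which needs the Kalman recursion or more about the
noises than their independence, their means and their covariances.

*Completion of the square.* With the Riccati matrices,
`‖A x + B u‖²_S + ‖u‖²_R = ‖x‖²_N + ‖u - K x‖²_M` (`LQGData.quadForm_step`), because
`(1 + S B R⁻¹ Bᵀ)⁻¹ = 1 - S B M⁻¹ Bᵀ` (`inv_one_add_mul_inv`). Since `w_t` is centred and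
independent of everything that enters `x_t` and `u_t`, and since `x̂_t - x_t` is orthogonal to every
square-integrable function of the measurements, the expected cost-to-go telescopes: a policy with
square-integrable controls has cost `g(S) + ∑ t, 𝔼‖u_t - K_t x̂_t‖²_{M_t}`
(`LQGData.Randomness.cost_eq`).

*No dual effect.* The state differs from the uncontrolled state by a function of the past controls,
which are functions of the measurements. Hence the measurements under any admissible policy generate
the same σ-algebra as those of the uncontrolled system
(`LQGData.Randomness.info_eq_info_zeroPolicy`), and the effect of the controls cancels in the
estimation error, whose covariance therefore depends on `S` alone
(`LQGData.Randomness.errorCovOf_eq_errorCov`).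

As `M_t` is positive definite, the deviation term vanishes exactly for the certainty-equivalent
policies. These exist (`LQGData.Randomness.exists_isCertaintyEquivalent`), so `g(S)` is the optimal
value for `S`; and `g` differs from the sensing objective by a constant, which settles the choice of
the sensor set. A policy of finite cost has square-integrable controls because `R_t` is positive
definite, and a certainty-equivalent policy has them by induction on time; this matters since the
conditional expectation of a non-integrable state is `0` by convention.
-/

/-! ### Quadratic forms -/

/-- The continuous linear map between Euclidean spaces given by a matrix. -/
noncomputable def matCLM {m n : ℕ} (A : Matrix (Fin m) (Fin n) ℝ) :
    EuclideanSpace ℝ (Fin n) →L[ℝ] EuclideanSpace ℝ (Fin m) :=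
  LinearMap.toContinuousLinearMap (toEuclideanLin A)

lemma ofLp_matCLM {m n : ℕ} (A : Matrix (Fin m) (Fin n) ℝ) (x : EuclideanSpace ℝ (Fin n)) :
    (matCLM A x).ofLp = A *ᵥ x.ofLp := rfl

lemma matCLM_mul {l m n : ℕ} (A : Matrix (Fin l) (Fin m) ℝ) (B : Matrix (Fin m) (Fin n) ℝ)
    (x : EuclideanSpace ℝ (Fin n)) : matCLM (A * B) x = matCLM A (matCLM B x) := by
  ext i
  simp [ofLp_matCLM, mulVec_mulVec]

lemma matCLM_one {n : ℕ} (x : EuclideanSpace ℝ (Fin n)) : matCLM 1 x = x := by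
  ext i
  simp [ofLp_matCLM]

lemma quadForm_eq_inner {d : ℕ} (P : Matrix (Fin d) (Fin d) ℝ) (x : EuclideanSpace ℝ (Fin d)) :
    quadForm P x = inner ℝ x (matCLM P x) := by
  rw [quadForm, EuclideanSpace.inner_eq_star_dotProduct, ofLp_matCLM, dotProduct_comm]
  simp

lemma continuous_quadForm {d : ℕ} (P : Matrix (Fin d) (Fin d) ℝ) : Continuous (quadForm P) := by
  have : quadForm P = fun x => inner ℝ x (matCLM P x) := funext (quadForm_eq_inner P)
  rw [this]
  fun_prop

lemma inner_matCLM_left {m n : ℕ} (A : Matrix (Fin m) (Fin n) ℝ) (x : EuclideanSpace ℝ (Fin n))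
    (y : EuclideanSpace ℝ (Fin m)) :
    inner ℝ (matCLM A x) y = inner ℝ x (matCLM Aᵀ y) := by
  simp only [EuclideanSpace.inner_eq_star_dotProduct, ofLp_matCLM, star_trivial]
  rw [dotProduct_mulVec, mulVec_transpose]

lemma quadForm_add {d : ℕ} {P : Matrix (Fin d) (Fin d) ℝ} (hP : Pᵀ = P)
    (x y : EuclideanSpace ℝ (Fin d)) :
    quadForm P (x + y) = quadForm P x + quadForm P y + 2 * inner ℝ x (matCLM P y) := by
  have h : inner ℝ y (matCLM P x) = inner ℝ x (matCLM P y) := by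
    rw [real_inner_comm, inner_matCLM_left, hP]
  simp only [quadForm_eq_inner, map_add, inner_add_left, inner_add_right, h]
  ring

lemma quadForm_neg {d : ℕ} (P : Matrix (Fin d) (Fin d) ℝ) (x : EuclideanSpace ℝ (Fin d)) :
    quadForm P (-x) = quadForm P x := by
  simp [quadForm_eq_inner]

lemma quadForm_matCLM {m n : ℕ} (P : Matrix (Fin m) (Fin m) ℝ) (A : Matrix (Fin m) (Fin n) ℝ)
    (x : EuclideanSpace ℝ (Fin n)) : quadForm P (matCLM A x) = quadForm (Aᵀ * P * A) x := by
  simp only [quadForm_eq_inner, inner_matCLM_left, matCLM_mul]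

lemma quadForm_add_matrix {d : ℕ} (P P' : Matrix (Fin d) (Fin d) ℝ)
    (x : EuclideanSpace ℝ (Fin d)) : quadForm (P + P') x = quadForm P x + quadForm P' x := by
  simp [quadForm, add_mulVec, dotProduct_add]

lemma quadForm_nonneg {d : ℕ} {P : Matrix (Fin d) (Fin d) ℝ} (hP : P.PosSemidef)
    (x : EuclideanSpace ℝ (Fin d)) : 0 ≤ quadForm P x := by
  simpa [quadForm] using hP.dotProduct_mulVec_nonneg x.ofLp

lemma transpose_eq_of_posSemidef {d : ℕ} {P : Matrix (Fin d) (Fin d) ℝ} (hP : P.PosSemidef) :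
    Pᵀ = P := by
  simpa [IsHermitian, conjTranspose_eq_transpose_of_trivial] using hP.isHermitian

/-- A positive definite form is coercive: with `P = Lᵀ L` and `L` invertible,
`‖x‖ = ‖L⁻¹ L x‖ ≤ ‖L⁻¹‖ ‖L x‖`. -/
lemma exists_norm_sq_le_mul_quadForm {d : ℕ} {P : Matrix (Fin d) (Fin d) ℝ} (hP : P.PosDef) :
    ∃ c : ℝ, ∀ x, ‖x‖ ^ 2 ≤ c * quadForm P x := by
  obtain ⟨L, hL⟩ : ∃ L : Matrix (Fin d) (Fin d) ℝ, P = Lᵀ * L := by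
    open scoped MatrixOrder in
    obtain ⟨L, hL⟩ := CStarAlgebra.nonneg_iff_eq_star_mul_self.mp hP.posSemidef.nonneg
    exact ⟨L, by rw [hL, star_eq_conjTranspose, conjTranspose_eq_transpose_of_trivial]⟩
  have hdet : IsUnit L.det := by
    have h := (isUnit_iff_isUnit_det P).mp hP.isUnit
    rw [hL, det_mul] at h
    exact isUnit_of_mul_isUnit_right h
  refine ⟨‖matCLM L⁻¹‖ ^ 2, fun x => ?_⟩
  have hx : x = matCLM L⁻¹ (matCLM L x) := by
    rw [← matCLM_mul, nonsing_inv_mul _ hdet, matCLM_one]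
  have hq : quadForm P x = ‖matCLM L x‖ ^ 2 := by
    rw [quadForm_eq_inner, hL, matCLM_mul, ← inner_matCLM_left, real_inner_self_eq_norm_sq]
  calc ‖x‖ ^ 2 = ‖matCLM L⁻¹ (matCLM L x)‖ ^ 2 := by rw [← hx]
    _ ≤ (‖matCLM L⁻¹‖ * ‖matCLM L x‖) ^ 2 := by
      gcongr
      exact (matCLM L⁻¹).le_opNorm _
    _ = _ := by rw [hq, mul_pow]

lemma eq_zero_of_quadForm_eq_zero {d : ℕ} {P : Matrix (Fin d) (Fin d) ℝ} (hP : P.PosDef)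
    {x : EuclideanSpace ℝ (Fin d)} (hx : quadForm P x = 0) : x = 0 := by
  obtain ⟨c, hc⟩ := exists_norm_sq_le_mul_quadForm hP
  have h := hc x
  rw [hx, mul_zero] at h
  simpa using le_antisymm h (by positivity)

/-! ### The Riccati recursion and completion of the square -/

section Square

variable {n n' m : ℕ} {S : Matrix (Fin n') (Fin n') ℝ} {R M : Matrix (Fin m) (Fin m) ℝ}
  {A : Matrix (Fin n') (Fin n) ℝ} {B : Matrix (Fin n') (Fin m) ℝ}

/-- The matrix identity behind the equivalence of the two forms of the Riccati recursion. -/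
lemma inv_one_add_mul_inv (hR : IsUnit R.det) (hM : IsUnit M.det) (hMdef : M = Bᵀ * S * B + R) :
    (1 + S * B * R⁻¹ * Bᵀ)⁻¹ = 1 - S * B * M⁻¹ * Bᵀ := by
  apply inv_eq_right_inv
  have key : R⁻¹ + -M⁻¹ + -(R⁻¹ * (Bᵀ * S * B) * M⁻¹) = 0 := by
    have h1 : R⁻¹ * (Bᵀ * S * B) * M⁻¹ = R⁻¹ * (M - R) * M⁻¹ := by rw [hMdef]; simp
    rw [h1, mul_sub, sub_mul, nonsing_inv_mul _ hR, Matrix.mul_assoc, mul_nonsing_inv _ hM,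
      Matrix.mul_one, Matrix.one_mul]
    abel
  calc (1 + S * B * R⁻¹ * Bᵀ) * (1 - S * B * M⁻¹ * Bᵀ)
      = 1 + S * B * (R⁻¹ + -M⁻¹ + -(R⁻¹ * (Bᵀ * S * B) * M⁻¹)) * Bᵀ := by
        simp only [Matrix.mul_add, Matrix.add_mul, Matrix.mul_sub, Matrix.mul_neg, Matrix.neg_mul,
          Matrix.mul_one, Matrix.one_mul, Matrix.mul_assoc]
        abel
    _ = 1 := by rw [key]; simp

variable {K : Matrix (Fin m) (Fin n) ℝ} {N : Matrix (Fin n) (Fin n) ℝ}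

/-- Completion of the square in the control `u`: the minimiser is `K x`, the minimum `‖x‖²_N`. -/
lemma quadForm_complete_square (hS : S.PosSemidef) (hMt : Mᵀ = M) (hMdef : M = Bᵀ * S * B + R)
    (hMK : M * K = -(Bᵀ * S * A)) (hN : N = Aᵀ * S * A - Kᵀ * M * K)
    (x : EuclideanSpace ℝ (Fin n)) (u : EuclideanSpace ℝ (Fin m)) :
    quadForm S (matCLM A x + matCLM B u) + quadForm R u =
      quadForm N x + quadForm M (u - matCLM K x) := by
  have hSt := transpose_eq_of_posSemidef hS
  have hN' : Aᵀ * S * A = N + Kᵀ * M * K := by rw [hN]; abel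
  have hcross : inner ℝ (matCLM A x) (matCLM S (matCLM B u)) =
      -inner ℝ u (matCLM M (matCLM K x)) := by
    have h : (S * B)ᵀ * A = -(M * K) := by rw [hMK, transpose_mul, hSt, neg_neg]
    rw [← matCLM_mul S B, ← matCLM_mul M K, ← real_inner_comm, inner_matCLM_left, ← matCLM_mul, h,
      ← inner_neg_right]
    congr 1
    ext i
    simp [ofLp_matCLM, neg_mulVec]
  rw [quadForm_add hSt, quadForm_matCLM, quadForm_matCLM, hN', hcross, sub_eq_add_neg,
    quadForm_add hMt, quadForm_neg, quadForm_matCLM, map_neg, inner_neg_right, hMdef,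
    quadForm_add_matrix, quadForm_add_matrix]
  ring

end Square

namespace LQGData

variable {V : Type*} (D : LQGData V)

lemma riccatiN_of_lt {t : ℕ} (ht : t < D.T) :
    D.riccatiN t = (D.A t)ᵀ * ((1 + D.riccatiS t * D.B t * (D.R t)⁻¹ * (D.B t)ᵀ)⁻¹ *
        D.riccatiS t) * D.A t := by
  rw [riccatiN, if_pos ht]
  rfl

lemma riccatiN_of_le {t : ℕ} (ht : D.T ≤ t) : D.riccatiN t = 0 := by
  rw [riccatiN, if_neg (by omega)]

/-! The positivity of `S t` enters as a hypothesis until it is known, by backward induction, that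
`N t` is positive semidefinite at all times. -/

variable {D} in
lemma riccatiM_posDef_of {t : ℕ} (ht : t < D.T) (hS : (D.riccatiS t).PosSemidef) :
    (D.riccatiM t).PosDef := by
  have h := hS.conjTranspose_mul_mul_same (D.B t)
  rw [conjTranspose_eq_transpose_of_trivial] at h
  exact PosDef.posSemidef_add h (D.R_posDef t ht)

variable {D} in
lemma riccatiM_mul_gainK_of {t : ℕ} (hM : IsUnit (D.riccatiM t).det) :
    D.riccatiM t * D.gainK t = -((D.B t)ᵀ * D.riccatiS t * D.A t) := by
  rw [gainK, Matrix.mul_neg, ← Matrix.mul_assoc, ← Matrix.mul_assoc, ← Matrix.mul_assoc,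
    mul_nonsing_inv _ hM, Matrix.one_mul]

variable {D} in
lemma riccatiN_eq_of {t : ℕ} (ht : t < D.T) (hS : (D.riccatiS t).PosSemidef) :
    D.riccatiN t = (D.A t)ᵀ * D.riccatiS t * D.A t -
      (D.gainK t)ᵀ * D.riccatiM t * D.gainK t := by
  have hMpd := riccatiM_posDef_of ht hS
  have hM := (isUnit_iff_isUnit_det _).mp hMpd.isUnit
  have hMt := transpose_eq_of_posSemidef hMpd.posSemidef
  have hR := (isUnit_iff_isUnit_det _).mp (D.R_posDef t ht).isUnit
  have hKt : (D.gainK t)ᵀ = -((D.A t)ᵀ * D.riccatiS t * D.B t * (D.riccatiM t)⁻¹) := by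
    simp [gainK, transpose_mul, transpose_nonsing_inv, hMt, transpose_eq_of_posSemidef hS,
      Matrix.mul_assoc]
  rw [riccatiN_of_lt D ht, inv_one_add_mul_inv hR hM rfl, Matrix.mul_assoc (D.gainK t)ᵀ,
    riccatiM_mul_gainK_of hM, hKt]
  simp [Matrix.mul_sub, Matrix.sub_mul, Matrix.mul_assoc]

lemma riccatiN_posSemidef (t : ℕ) : (D.riccatiN t).PosSemidef := by
  by_cases ht : t < D.T
  · have hS : (D.riccatiS t).PosSemidef := (D.Q_posSemidef t ht).add (riccatiN_posSemidef (t + 1))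
    have hMpd := riccatiM_posDef_of ht hS
    have hMt := transpose_eq_of_posSemidef hMpd.posSemidef
    have hN := riccatiN_eq_of ht hS
    have hM := (isUnit_iff_isUnit_det _).mp hMpd.isUnit
    refine PosSemidef.of_dotProduct_mulVec_nonneg ?_ fun x => ?_
    · rw [hN, IsHermitian, conjTranspose_eq_transpose_of_trivial]
      simp [transpose_mul, hMt, transpose_eq_of_posSemidef hS, Matrix.mul_assoc]
    · -- the value of the completed square at the minimising control `u = K x`
      have h := quadForm_complete_square hS hMt rfl (riccatiM_mul_gainK_of hM) hN
        (WithLp.toLp 2 x) (matCLM (D.gainK t) (WithLp.toLp 2 x))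
      have h0 : quadForm (D.riccatiM t) 0 = 0 := by simp [quadForm]
      rw [sub_self, h0, add_zero] at h
      have h' : star x ⬝ᵥ (D.riccatiN t *ᵥ x) = quadForm (D.riccatiN t) (WithLp.toLp 2 x) := rfl
      rw [h', ← h]
      exact add_nonneg (quadForm_nonneg hS _) (quadForm_nonneg (D.R_posDef t ht).posSemidef _)
  · rw [D.riccatiN_of_le (by omega)]
    exact PosSemidef.zero
termination_by D.T - t

variable {D} {t : ℕ}

lemma riccatiS_posSemidef (ht : t < D.T) : (D.riccatiS t).PosSemidef :=
  (D.Q_posSemidef t ht).add (D.riccatiN_posSemidef (t + 1))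

lemma riccatiM_posDef (ht : t < D.T) : (D.riccatiM t).PosDef :=
  riccatiM_posDef_of ht (riccatiS_posSemidef ht)

lemma quadForm_step (ht : t < D.T) (x : EuclideanSpace ℝ (Fin (D.n t)))
    (u : EuclideanSpace ℝ (Fin (D.m t))) :
    quadForm (D.riccatiS t) (matCLM (D.A t) x + matCLM (D.B t) u) + quadForm (D.R t) u =
      quadForm (D.riccatiN t) x + quadForm (D.riccatiM t) (u - matCLM (D.gainK t) x) :=
  quadForm_complete_square (riccatiS_posSemidef ht)
    (transpose_eq_of_posSemidef (riccatiM_posDef ht).posSemidef) rfl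
    (riccatiM_mul_gainK_of ((isUnit_iff_isUnit_det _).mp (riccatiM_posDef ht).isUnit))
    (riccatiN_eq_of ht (riccatiS_posSemidef ht)) x u

lemma riccatiN_eq_of_isUnit (ht : t < D.T) (hS : IsUnit (D.riccatiS t)) :
    D.riccatiN t =
      (D.A t)ᵀ * ((D.riccatiS t)⁻¹ + D.B t * (D.R t)⁻¹ * (D.B t)ᵀ)⁻¹ * D.A t := by
  have hdet := (isUnit_iff_isUnit_det _).mp hS
  have h : (D.riccatiS t)⁻¹ + D.B t * (D.R t)⁻¹ * (D.B t)ᵀ =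
      (D.riccatiS t)⁻¹ * (1 + D.riccatiS t * D.B t * (D.R t)⁻¹ * (D.B t)ᵀ) := by
    simp only [Matrix.mul_add, Matrix.mul_one, Matrix.mul_assoc]
    rw [nonsing_inv_mul_cancel_left _ _ hdet]
  rw [riccatiN_of_lt D ht, h, Matrix.mul_inv_rev, nonsing_inv_nonsing_inv _ hdet]

end LQGData

/-! ### Square-integrable random vectors -/

section Probability

variable {Ω : Type*} {m₀ : MeasurableSpace Ω} {μ : Measure Ω}

lemma memLp_matCLM {d d' : ℕ} (A : Matrix (Fin d') (Fin d) ℝ) {z : Ω → EuclideanSpace ℝ (Fin d)}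
    (hz : MemLp z 2 μ) : MemLp (fun ω => matCLM A (z ω)) 2 μ :=
  (matCLM A).comp_memLp' hz

lemma integrable_inner_of_memLp_two {d : ℕ} {z e : Ω → EuclideanSpace ℝ (Fin d)}
    (hz : MemLp z 2 μ) (he : MemLp e 2 μ) : Integrable (fun ω => inner ℝ (z ω) (e ω)) μ :=
  (hz.norm.integrable_mul he.norm).mono' (hz.1.inner he.1)
    (ae_of_all _ fun _ => norm_inner_le_norm _ _)

lemma integrable_inner_matCLM {d d' : ℕ} (A : Matrix (Fin d') (Fin d) ℝ)
    {z : Ω → EuclideanSpace ℝ (Fin d')} {e : Ω → EuclideanSpace ℝ (Fin d)}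
    (hz : MemLp z 2 μ) (he : MemLp e 2 μ) :
    Integrable (fun ω => inner ℝ (z ω) (matCLM A (e ω))) μ :=
  integrable_inner_of_memLp_two hz (memLp_matCLM A he)

lemma integrable_quadForm {d : ℕ} (P : Matrix (Fin d) (Fin d) ℝ)
    {z : Ω → EuclideanSpace ℝ (Fin d)} (hz : MemLp z 2 μ) :
    Integrable (fun ω => quadForm P (z ω)) μ := by
  simp only [quadForm_eq_inner]
  exact integrable_inner_matCLM P hz hz

lemma integral_quadForm {d : ℕ} (P : Matrix (Fin d) (Fin d) ℝ)
    {z : Ω → EuclideanSpace ℝ (Fin d)} (hz : MemLp z 2 μ) :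
    ∫ ω, quadForm P (z ω) ∂μ = (P * Matrix.of fun a b => ∫ ω, z ω a * z ω b ∂μ).trace := by
  have hc (a : Fin d) : MemLp (fun ω => z ω a) 2 μ := hz.eval_piLp a
  have hi (a b : Fin d) : Integrable (fun ω => P a b * (z ω b * z ω a)) μ :=
    ((hc b).integrable_mul (hc a)).const_mul _
  have h (ω : Ω) : quadForm P (z ω) = ∑ a, ∑ b, P a b * (z ω b * z ω a) := by
    simp only [quadForm, dotProduct, mulVec, Finset.mul_sum]
    exact Finset.sum_congr rfl fun a _ => Finset.sum_congr rfl fun b _ => by ring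
  simp only [h, trace, diag_apply, mul_apply, of_apply]
  rw [integral_finsetSum _ fun a _ => integrable_finsetSum _ fun b _ => hi a b]
  refine Finset.sum_congr rfl fun a _ => ?_
  rw [integral_finsetSum _ fun b _ => hi a b]
  exact Finset.sum_congr rfl fun b _ => integral_const_mul _ _

/-- Orthogonality: a random vector with vanishing conditional expectation given `m` is
uncorrelated with every square-integrable `m`-measurable random vector. -/
lemma integral_inner_eq_zero_of_condExp [IsFiniteMeasure μ] {m : MeasurableSpace Ω} (hm : m ≤ m₀)
    {d : ℕ} {z e : Ω → EuclideanSpace ℝ (Fin d)} (hz : MemLp z 2 μ)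
    (hzm : AEStronglyMeasurable[m] z μ) (he : MemLp e 2 μ) (hem : μ[e | m] =ᵐ[μ] 0) :
    ∫ ω, inner ℝ (z ω) (e ω) ∂μ = 0 := by
  have h := condExp_bilin_of_aestronglyMeasurable_left (innerSL ℝ) hzm
    (integrable_inner_of_memLp_two hz he) (he.integrable one_le_two)
  rw [← integral_condExp hm]
  refine integral_eq_zero_of_ae ?_
  filter_upwards [h, hem] with ω h1 h2
  have h1' : (μ[fun ω => inner ℝ (z ω) (e ω) | m]) ω = inner ℝ (z ω) ((μ[e | m]) ω) := h1
  rw [h1', h2]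
  simp

lemma condExp_sub_condExp_self [IsFiniteMeasure μ] {m : MeasurableSpace Ω} (hm : m ≤ m₀) {d : ℕ}
    {x : Ω → EuclideanSpace ℝ (Fin d)} (hx : Integrable x μ) : μ[μ[x | m] - x | m] =ᵐ[μ] 0 := by
  have h := condExp_sub (integrable_condExp (f := x) (m := m) (μ := μ)) hx m
  rw [condExp_of_stronglyMeasurable hm stronglyMeasurable_condExp integrable_condExp] at h
  simpa using h

/-- The second moment of `u - K x`, where `u` is known to the observer `m`, splits into that of
`u - K 𝔼[x | m]` and a contribution of the estimation error. -/
lemma integral_quadForm_sub_condExp [IsFiniteMeasure μ] {m : MeasurableSpace Ω} (hm : m ≤ m₀)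
    {n d : ℕ} {P : Matrix (Fin d) (Fin d) ℝ} (hP : Pᵀ = P) (K : Matrix (Fin d) (Fin n) ℝ)
    {x : Ω → EuclideanSpace ℝ (Fin n)} {u : Ω → EuclideanSpace ℝ (Fin d)}
    (hx : MemLp x 2 μ) (hu : MemLp u 2 μ) (hum : AEStronglyMeasurable[m] u μ) :
    ∫ ω, quadForm P (u ω - matCLM K (x ω)) ∂μ =
      ∫ ω, quadForm P (u ω - matCLM K (μ[x | m] ω)) ∂μ +
        ∫ ω, quadForm (Kᵀ * P * K) ((μ[x | m] - x) ω) ∂μ := by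
  have hxh : MemLp (μ[x | m]) 2 μ := hx.condExp one_le_two
  have hd : MemLp (fun ω => u ω - matCLM K (μ[x | m] ω)) 2 μ := hu.sub (memLp_matCLM K hxh)
  have he : MemLp (μ[x | m] - x) 2 μ := hxh.sub hx
  have hdm : AEStronglyMeasurable[m] (fun ω => u ω - matCLM K (μ[x | m] ω)) μ :=
    hum.sub ((matCLM K).continuous.comp_aestronglyMeasurable
      stronglyMeasurable_condExp.aestronglyMeasurable)
  have hort : ∫ ω, inner ℝ (u ω - matCLM K (μ[x | m] ω))
      (matCLM (P * K) ((μ[x | m] - x) ω)) ∂μ = 0 := by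
    refine integral_inner_eq_zero_of_condExp hm hd hdm (memLp_matCLM _ he) ?_
    refine ((matCLM (P * K)).comp_condExp_comm (he.integrable one_le_two)).symm.trans ?_
    filter_upwards [condExp_sub_condExp_self hm (hx.integrable one_le_two)] with ω hω
    simp only [Function.comp_apply, hω]
    simp
  have h (ω : Ω) : quadForm P (u ω - matCLM K (x ω)) =
      quadForm P (u ω - matCLM K (μ[x | m] ω)) + quadForm (Kᵀ * P * K) ((μ[x | m] - x) ω) +
        2 * inner ℝ (u ω - matCLM K (μ[x | m] ω)) (matCLM (P * K) ((μ[x | m] - x) ω)) := by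
    rw [← quadForm_matCLM, matCLM_mul, ← quadForm_add hP]
    simp
  simp only [h]
  rw [integral_add (Integrable.fun_add (integrable_quadForm _ hd) (integrable_quadForm _ he))
    ((integrable_inner_matCLM _ hd he).const_mul 2),
    integral_add (integrable_quadForm _ hd) (integrable_quadForm _ he), integral_const_mul, hort]
  simp

/-- A measurable random vector of finite mean square, measured in a positive definite norm, is
square-integrable. -/
lemma memLp_two_of_lintegral_quadForm {d : ℕ} {P : Matrix (Fin d) (Fin d) ℝ} (hP : P.PosDef)
    {u : Ω → EuclideanSpace ℝ (Fin d)} (hu : Measurable u)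
    (h : ∫⁻ ω, ENNReal.ofReal (quadForm P (u ω)) ∂μ ≠ ∞) : MemLp u 2 μ := by
  obtain ⟨c, hc⟩ := exists_norm_sq_le_mul_quadForm hP
  have hq : Integrable (fun ω => quadForm P (u ω)) μ := by
    refine ⟨((continuous_quadForm P).measurable.comp hu).aestronglyMeasurable, ?_⟩
    rw [hasFiniteIntegral_iff_ofReal (ae_of_all _ fun ω => quadForm_nonneg hP.posSemidef _)]
    exact h.lt_top
  rw [memLp_two_iff_integrable_sq_norm hu.aestronglyMeasurable]
  refine (hq.const_mul c).mono' (by fun_prop) (ae_of_all _ fun ω => ?_)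
  rw [Real.norm_of_nonneg (by positivity)]
  exact hc _

variable {d : ℕ} {c : EuclideanSpace ℝ (Fin d)} {W : Matrix (Fin d) (Fin d) ℝ}
  {w : Ω → EuclideanSpace ℝ (Fin d)}

lemma memLp_two_of_map_eq_multivariateGaussian (hw : Measurable w)
    (h : μ.map w = multivariateGaussian c W) : MemLp w 2 μ := by
  have h2 : MemLp id 2 (μ.map w) := h ▸ IsGaussian.memLp_two_id
  exact (memLp_map_measure_iff h2.1 hw.aemeasurable).mp h2

lemma integral_eq_of_map_eq_multivariateGaussian (hw : Measurable w)
    (h : μ.map w = multivariateGaussian c W) : ∫ ω, w ω ∂μ = c := by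
  have h2 := integral_map hw.aemeasurable
    (aestronglyMeasurable_id (α := EuclideanSpace ℝ (Fin d)) (μ := μ.map w))
  simp only [id_eq] at h2
  rw [← h2, h, integral_id_multivariateGaussian]

lemma integral_quadForm_of_map_eq_multivariateGaussian (hw : Measurable w) (hW : W.PosSemidef)
    (h : μ.map w = multivariateGaussian 0 W) (P : Matrix (Fin d) (Fin d) ℝ) :
    ∫ ω, quadForm P (w ω) ∂μ = (W * P).trace := by
  have hmem := memLp_two_of_map_eq_multivariateGaussian hw h
  rw [integral_quadForm P hmem, trace_mul_comm]
  congr 2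
  ext a b
  have hG : MemLp id 2 (multivariateGaussian (0 : EuclideanSpace ℝ (Fin d)) W) :=
    IsGaussian.memLp_two_id
  have hmean (a : Fin d) : ∫ x : EuclideanSpace ℝ (Fin d), x a ∂multivariateGaussian 0 W = 0 := by
    have h1 := (EuclideanSpace.proj (𝕜 := ℝ) a).integral_comp_comm (hG.integrable one_le_two)
    simpa using h1
  have hcov := covariance_eval_multivariateGaussian (μ := (0 : EuclideanSpace ℝ (Fin d))) hW a b
  have hGc (a : Fin d) : MemLp (fun x : EuclideanSpace ℝ (Fin d) => x a) 2
      (multivariateGaussian 0 W) := hG.eval_piLp a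
  rw [covariance_eq_sub (hGc a) (hGc b), hmean, hmean, mul_zero, sub_zero,
    ← h] at hcov
  have hint : AEStronglyMeasurable ((fun x : EuclideanSpace ℝ (Fin d) => x a) * fun x => x b)
      (μ.map w) := by fun_prop
  rw [integral_map hw.aemeasurable hint] at hcov
  exact hcov

end Probability

/-- `measurable_pi_lambda` for a σ-algebra on the domain that is not found by instance search. -/
lemma measurable_pi_of_apply {α ι : Type*} {β : ι → Type*} {m : MeasurableSpace α}
    [∀ i, MeasurableSpace (β i)] {f : α → ∀ i, β i} (h : ∀ i, Measurable[m] fun a => f a i) :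
    Measurable[m] f :=
  measurable_pi_lambda f h

namespace LQGData

/-! ### Closed-loop dynamics -/

variable {V : Type*} {D : LQGData V}

lemma admissible_zeroPolicy (S : Finset V) : Admissible (D.zeroPolicy S) :=
  fun _ _ => measurable_const

namespace Randomness

variable {Ω : Type*} {m : MeasurableSpace Ω} [mΩ : MeasurableSpace Ω] {μ : Measure Ω}
  (X : D.Randomness μ)
  {S : Finset V} {π : D.Policy S} {t : ℕ}

lemma state_zero (π : D.Policy S) (ω : Ω) : X.state π 0 ω = X.x₀ ω := by
  rw [state]

lemma state_succ (π : D.Policy S) (t : ℕ) (ω : Ω) :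
    X.state π (t + 1) ω =
      matCLM (D.A t) (X.state π t ω) + matCLM (D.B t) (X.control π t ω) + X.w t ω := by
  rw [state]
  rfl

lemma history_apply (π : D.Policy S) (t : ℕ) (ω : Ω) (s : Fin (t + 1)) (i : S) :
    X.history π t ω s i = matCLM (D.C i s) (X.state π s ω) + X.v i s ω := rfl

lemma control_zeroPolicy (t : ℕ) (ω : Ω) : X.control (D.zeroPolicy S) t ω = 0 := rfl

lemma state_congr {π π' : D.Policy S} (h : ∀ s < t, π s = π' s) :
    ∀ s ≤ t, X.state π s = X.state π' s := by
  intro s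
  induction s using Nat.strong_induction_on with
  | _ s ih =>
    intro hs
    cases s with
    | zero => funext ω; rw [state_zero, state_zero]
    | succ s =>
      have hh (ω : Ω) : X.history π s ω = X.history π' s ω := by
        funext r i
        rw [history_apply, history_apply, ih r (by omega) (by omega)]
      funext ω
      rw [state_succ, state_succ, ih s (by omega) (by omega), control, control, hh,
        h s (by omega)]

lemma history_congr {π π' : D.Policy S} (h : ∀ s < t, π s = π' s) :
    X.history π t = X.history π' t := by
  funext ω r i
  rw [history_apply, history_apply, X.state_congr h r (by omega)]

lemma measurable_history (hx : ∀ s ≤ t, Measurable[m] (X.state π s))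
    (hv : ∀ i, ∀ s ≤ t, Measurable[m] (X.v i s)) : Measurable[m] (X.history π t) := by
  refine measurable_pi_of_apply fun s => measurable_pi_of_apply fun i => ?_
  exact ((matCLM (D.C i s)).measurable.comp (hx s (by omega))).add (hv i s (by omega))

lemma measurable_control (hπ : Admissible π) (ht : t < D.T)
    (hy : Measurable[m] (X.history π t)) : Measurable[m] (X.control π t) :=
  (hπ t ht).comp hy

/-- The state at time `t` is a measurable function of the noises before time `t`. -/
lemma measurable_state_of_noise (hπ : Admissible π) (ht : t ≤ D.T)
    (hx : Measurable[m] X.x₀) (hw : ∀ s < t, Measurable[m] (X.w s))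
    (hv : ∀ i, ∀ s < t, Measurable[m] (X.v i s)) : Measurable[m] (X.state π t) := by
  induction t using Nat.strong_induction_on with
  | _ t ih =>
    cases t with
    | zero =>
      rw [funext (X.state_zero π)]
      exact hx
    | succ t =>
      have hs (s : ℕ) (hst : s ≤ t) : Measurable[m] (X.state π s) :=
        ih s (by omega) (by omega) (fun r hr => hw r (by omega)) fun i r hr => hv i r (by omega)
      have hu := X.measurable_control hπ ht
        (X.measurable_history hs fun i s hst => hv i s (by omega))
      rw [funext (X.state_succ π t)]
      exact (((matCLM (D.A t)).measurable.comp (hs t le_rfl)).add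
        ((matCLM (D.B t)).measurable.comp hu)).add (hw t (by omega))

lemma measurable_state (hπ : Admissible π) (ht : t ≤ D.T) : Measurable (X.state π t) :=
  X.measurable_state_of_noise hπ ht X.measurable_x₀ (fun s hs => X.measurable_w s (by omega))
    fun i s hs => X.measurable_v i s (by omega)

lemma measurable_history_of_lt (hπ : Admissible π) (ht : t < D.T) :
    Measurable (X.history π t) :=
  X.measurable_history (fun s hs => X.measurable_state hπ (by omega))
    fun i s hs => X.measurable_v i s (by omega)

lemma info_le (hπ : Admissible π) (ht : t < D.T) : X.info π t ≤ mΩ :=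
  (X.measurable_history_of_lt hπ ht).comap_le

lemma info_mono {s t : ℕ} (hst : s ≤ t) : X.info π s ≤ X.info π t := by
  have h : Measurable[X.info π t] (X.history π s) := by
    refine measurable_pi_of_apply fun r => ?_
    exact (measurable_pi_apply (⟨r, by omega⟩ : Fin (t + 1))).comp
      (comap_measurable (X.history π t))
  exact h.comap_le

lemma measurable_control_info (hπ : Admissible π) (ht : t < D.T) :
    Measurable[X.info π t] (X.control π t) :=
  X.measurable_control hπ ht (comap_measurable _)

/-! ### Independence of the process noise from the past -/

/-- The σ-algebras generated by the initial state, the process noises and the measurement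
noises. -/
@[reducible]
def noiseInfo : Unit ⊕ (Fin D.T ⊕ (V × Fin D.T)) → MeasurableSpace Ω :=
  Sum.elim (fun _ : Unit => MeasurableSpace.comap X.x₀ inferInstance)
    (Sum.elim (fun t : Fin D.T => MeasurableSpace.comap (X.w t) inferInstance)
      (fun it : V × Fin D.T => MeasurableSpace.comap (X.v it.1 it.2) inferInstance))

/-- The noises that enter the state and the measurements at time `t`: the initial state, the
process noises at times `s < t` and the measurement noises at times `s ≤ t`. -/
def pastIndex (D : LQGData V) (t : ℕ) : Set (Unit ⊕ (Fin D.T ⊕ (V × Fin D.T))) :=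
  {j | Sum.elim (fun _ : Unit => True) (Sum.elim (fun s : Fin D.T => (s : ℕ) < t)
    (fun it : V × Fin D.T => (it.2 : ℕ) ≤ t)) j}

/-- The σ-algebra generated by the noises that enter the state and the measurements at
time `t`. -/
@[reducible]
def past (t : ℕ) : MeasurableSpace Ω := ⨆ j ∈ pastIndex D t, X.noiseInfo j

lemma inl_mem_pastIndex (t : ℕ) : Sum.inl () ∈ pastIndex D t := trivial

lemma inr_inl_mem_pastIndex {t : ℕ} {s : Fin D.T} :
    Sum.inr (Sum.inl s) ∈ pastIndex D t ↔ (s : ℕ) < t := Iff.rfl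

lemma inr_inr_mem_pastIndex {t : ℕ} {it : V × Fin D.T} :
    Sum.inr (Sum.inr it) ∈ pastIndex D t ↔ (it.2 : ℕ) ≤ t := Iff.rfl

lemma noiseInfo_le (j : Unit ⊕ (Fin D.T ⊕ (V × Fin D.T))) : X.noiseInfo j ≤ mΩ := by
  rcases j with _ | s | ⟨i, s⟩
  · exact X.measurable_x₀.comap_le
  · exact (X.measurable_w s s.2).comap_le
  · exact (X.measurable_v i s s.2).comap_le

lemma past_le (t : ℕ) : X.past t ≤ mΩ :=
  iSup₂_le fun j _ => X.noiseInfo_le j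

lemma noiseInfo_le_past {j : Unit ⊕ (Fin D.T ⊕ (V × Fin D.T))} (hj : j ∈ pastIndex D t) :
    X.noiseInfo j ≤ X.past t :=
  le_iSup₂_of_le j hj le_rfl

lemma indep_past_w (ht : t < D.T) :
    Indep (MeasurableSpace.comap (X.w t) inferInstance) (X.past t) μ := by
  have h := indep_iSup_of_disjoint X.noiseInfo_le X.indep
    (S := {Sum.inr (Sum.inl ⟨t, ht⟩)}) (T := pastIndex D t)
    (Set.disjoint_singleton_left.mpr (by rw [inr_inl_mem_pastIndex]; exact lt_irrefl t))
  rw [iSup_singleton] at h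
  exact h

lemma measurable_past_x₀ : Measurable[X.past t] X.x₀ :=
  (comap_measurable X.x₀).mono
    (X.noiseInfo_le_past (inl_mem_pastIndex t)) le_rfl

lemma measurable_past_w (ht : t ≤ D.T) {s : ℕ} (hs : s < t) : Measurable[X.past t] (X.w s) :=
  (comap_measurable (X.w s)).mono
    (X.noiseInfo_le_past (inr_inl_mem_pastIndex (s := ⟨s, by omega⟩).mpr hs)) le_rfl

lemma measurable_past_v (ht : t < D.T) (i : V) {s : ℕ} (hs : s ≤ t) :
    Measurable[X.past t] (X.v i s) :=
  (comap_measurable (X.v i s)).mono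
    (X.noiseInfo_le_past (inr_inr_mem_pastIndex (it := (i, ⟨s, by omega⟩)).mpr hs)) le_rfl

lemma measurable_past_state (hπ : Admissible π) (ht : t < D.T) {s : ℕ} (hs : s ≤ t) :
    Measurable[X.past t] (X.state π s) :=
  X.measurable_state_of_noise hπ (by omega) X.measurable_past_x₀
    (fun r hr => X.measurable_past_w ht.le (by omega))
    fun i r hr => X.measurable_past_v ht i (by omega)

lemma measurable_past_control (hπ : Admissible π) (ht : t < D.T) :
    Measurable[X.past t] (X.control π t) :=
  X.measurable_control hπ ht (X.measurable_history (fun _ hs => X.measurable_past_state hπ ht hs)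
    fun i _ hs => X.measurable_past_v ht i hs)

lemma memLp_w (ht : t < D.T) : MemLp (X.w t) 2 μ :=
  memLp_two_of_map_eq_multivariateGaussian (X.measurable_w t ht) (X.law_w t ht)

/-- The process noise is centred and independent of the past. -/
lemma condExp_past_w [IsProbabilityMeasure μ] (ht : t < D.T) : μ[X.w t | X.past t] =ᵐ[μ] 0 := by
  have h := condExp_indep_eq (μ := μ) (X.measurable_w t ht).comap_le (X.past_le t)
    (comap_measurable (X.w t)).stronglyMeasurable (X.indep_past_w ht)
  rw [integral_eq_of_map_eq_multivariateGaussian (X.measurable_w t ht) (X.law_w t ht)] at h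
  exact h

/-! ### Separation: the information and the estimation error do not depend on the policy -/

/-- The effect of the controls on the state obeys the noise-free dynamics. -/
lemma state_sub_state_zeroPolicy_succ (π : D.Policy S) (t : ℕ) (ω : Ω) :
    X.state π (t + 1) ω - X.state (D.zeroPolicy S) (t + 1) ω =
      matCLM (D.A t) (X.state π t ω - X.state (D.zeroPolicy S) t ω) +
        matCLM (D.B t) (X.control π t ω) := by
  rw [state_succ, state_succ, control_zeroPolicy, map_sub, map_zero]
  abel

lemma measurable_state_sub (h : ∀ s < t, Measurable[m] (X.control π s)) :
    Measurable[m] fun ω => X.state π t ω - X.state (D.zeroPolicy S) t ω := by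
  induction t with
  | zero =>
    simp only [state_zero, sub_self]
    exact measurable_const
  | succ t ih =>
    simp only [state_sub_state_zeroPolicy_succ]
    exact ((matCLM (D.A t)).measurable.comp (ih fun s hs => h s (by omega))).add
      ((matCLM (D.B t)).measurable.comp (h t (by omega)))

lemma measurable_state_sub_of_info_le (hπ : Admissible π) (ht : t < D.T)
    (hm : ∀ s < t, X.info π s ≤ m) (s : Fin (t + 1)) :
    Measurable[m] fun ω => X.state π s ω - X.state (D.zeroPolicy S) s ω :=
  X.measurable_state_sub fun r hr =>
    (X.measurable_control_info hπ (by omega)).mono (hm r (by omega)) le_rfl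

lemma memLp_state_sub (h : ∀ s < t, MemLp (X.control π s) 2 μ) :
    MemLp (fun ω => X.state π t ω - X.state (D.zeroPolicy S) t ω) 2 μ := by
  induction t with
  | zero =>
    simp only [state_zero, sub_self]
    exact MemLp.zero'
  | succ t ih =>
    simp only [state_sub_state_zeroPolicy_succ]
    exact (memLp_matCLM _ (ih fun s hs => h s (by omega))).add
      (memLp_matCLM _ (h t (by omega)))

/-- No dual effect: the measurements under any admissible policy carry the same information as
those of the uncontrolled system, because the effect of the controls on the measurements can be
computed from the measurements. -/
lemma info_eq_info_zeroPolicy (hπ : Admissible π) (ht : t < D.T) :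
    X.info π t = X.info (D.zeroPolicy S) t := by
  induction t using Nat.strong_induction_on with
  | _ t ih =>
    apply le_antisymm
    · refine Measurable.comap_le
        (measurable_pi_of_apply fun s => measurable_pi_of_apply fun i => ?_)
      have h0 := (measurable_pi_apply i).comp
        ((measurable_pi_apply s).comp (comap_measurable (X.history (D.zeroPolicy S) t)))
      have h1 := X.measurable_state_sub_of_info_le hπ ht (m := X.info (D.zeroPolicy S) t)
        (fun r hr => (ih r hr (by omega)).le.trans (X.info_mono hr.le)) s
      convert h0.add ((matCLM (D.C i s)).measurable.comp h1) using 1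
      funext ω
      simp only [Pi.add_apply, Function.comp_apply, history_apply, map_sub]
      abel
    · refine Measurable.comap_le
        (measurable_pi_of_apply fun s => measurable_pi_of_apply fun i => ?_)
      have h0 := (measurable_pi_apply i).comp
        ((measurable_pi_apply s).comp (comap_measurable (X.history π t)))
      have h1 := X.measurable_state_sub_of_info_le hπ ht (m := X.info π t)
        (fun r hr => X.info_mono hr.le) s
      convert h0.sub ((matCLM (D.C i s)).measurable.comp h1) using 1
      funext ω
      simp only [Pi.sub_apply, Function.comp_apply, history_apply, map_sub]
      abel

lemma memLp_x₀ : MemLp X.x₀ 2 μ :=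
  memLp_two_of_map_eq_multivariateGaussian X.measurable_x₀ X.law_x₀

lemma memLp_state (ht : t ≤ D.T) (h : ∀ s < t, MemLp (X.control π s) 2 μ) :
    MemLp (X.state π t) 2 μ := by
  induction t with
  | zero =>
    rw [funext (X.state_zero π)]
    exact X.memLp_x₀
  | succ t ih =>
    rw [funext (X.state_succ π t)]
    exact ((memLp_matCLM _ (ih (by omega) fun s hs => h s (by omega))).add
      (memLp_matCLM _ (h t (by omega)))).add (X.memLp_w (by omega))

/-- The effect of the controls on the state is known to the estimator, hence cancels in the
estimation error. -/
lemma estimate_sub_state_ae_eq [IsProbabilityMeasure μ] (hπ : Admissible π) (ht : t < D.T)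
    (h : ∀ s < t, MemLp (X.control π s) 2 μ) :
    X.estimate π t - X.state π t =ᵐ[μ]
      X.estimate (D.zeroPolicy S) t - X.state (D.zeroPolicy S) t := by
  have hz := X.memLp_state_sub h
  have hzm : Measurable[X.info π t] fun ω => X.state π t ω - X.state (D.zeroPolicy S) t ω :=
    X.measurable_state_sub fun s hs =>
      (X.measurable_control_info hπ (by omega)).mono (X.info_mono hs.le) le_rfl
  have hx0 : MemLp (X.state (D.zeroPolicy S) t) 2 μ := X.memLp_state ht.le fun s _ => MemLp.zero
  have hsum : X.state π t = X.state (D.zeroPolicy S) t +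
      fun ω => X.state π t ω - X.state (D.zeroPolicy S) t ω := by
    funext ω
    simp
  have hc := condExp_add (hx0.integrable one_le_two) (hz.integrable one_le_two) (X.info π t)
  rw [← hsum, condExp_of_stronglyMeasurable (X.info_le hπ ht) hzm.stronglyMeasurable
    (hz.integrable one_le_two)] at hc
  unfold estimate
  rw [← X.info_eq_info_zeroPolicy hπ ht]
  filter_upwards [hc] with ω hω
  simp only [Pi.sub_apply, hω, Pi.add_apply]
  abel

lemma errorCovOf_eq_errorCov [IsProbabilityMeasure μ] (hπ : Admissible π) (ht : t < D.T)
    (h : ∀ s < t, MemLp (X.control π s) 2 μ) : X.errorCovOf π t = X.errorCov S t := by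
  unfold errorCov errorCovOf
  ext a b
  refine integral_congr_ae ?_
  filter_upwards [X.estimate_sub_state_ae_eq hπ ht h] with ω hω
  have hc (a : Fin (D.n t)) : X.estimate π t ω a - X.state π t ω a =
      X.estimate (D.zeroPolicy S) t ω a - X.state (D.zeroPolicy S) t ω a :=
    congrArg (fun z : EuclideanSpace ℝ (Fin (D.n t)) => z a) hω
  rw [hc, hc]

end Randomness

end LQGData

namespace LQGData

namespace Randomness

variable {V : Type*} {D : LQGData V} {Ω : Type*} [MeasurableSpace Ω] {μ : Measure Ω}
  (X : D.Randomness μ) {S : Finset V} {π : D.Policy S} {t : ℕ}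

/-! ### Certainty-equivalent policies -/

/-- The certainty-equivalent policy is built forward in time: the estimator at time `t` is a
measurable function of the measurements up to time `t`, and depends only on the control laws
before time `t`. -/
lemma exists_isCertaintyEquivalent (S : Finset V) :
    ∃ π : D.Policy S, Admissible π ∧ X.IsCertaintyEquivalent π := by
  suffices h : ∀ r ≤ D.T, ∃ π : D.Policy S, Admissible π ∧
      ∀ t < r, ∀ᵐ ω ∂μ, X.control π t ω = toEuclideanLin (D.gainK t) (X.estimate π t ω) from
    h D.T le_rfl
  intro r
  induction r with
  | zero => exact fun _ => ⟨D.zeroPolicy S, admissible_zeroPolicy S, fun t ht => by omega⟩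
  | succ r ih =>
    intro hr
    obtain ⟨π, hπ, hce⟩ := ih (by omega)
    obtain ⟨f, hf, hfe⟩ := (stronglyMeasurable_condExp (μ := μ) (m := X.info π r)
      (f := X.state π r)).exists_eq_measurable_comp
    let π' : D.Policy S := Function.update π r fun y => matCLM (D.gainK r) (f y)
    have hlt (t : ℕ) (ht : t ≠ r) : π' t = π t := Function.update_of_ne ht _ _
    have hr' : π' r = fun y => matCLM (D.gainK r) (f y) := Function.update_self _ _ _
    have hhist (t : ℕ) (ht : t ≤ r) : X.history π' t = X.history π t :=
      X.history_congr fun s hs => hlt s (by omega)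
    have hest (t : ℕ) (ht : t ≤ r) : X.estimate π' t = X.estimate π t := by
      have hs : X.state π' t = X.state π t :=
        X.state_congr (fun s hs => hlt s (by omega)) t le_rfl
      simp only [estimate, info, hs, hhist t ht]
    refine ⟨π', fun t ht => ?_, fun t ht => ?_⟩
    · by_cases h : t = r
      · subst h
        rw [hr']
        exact (matCLM (D.gainK t)).measurable.comp hf.measurable
      · rw [hlt t h]
        exact hπ t ht
    · rw [hest t (by omega)]
      by_cases h : t = r
      · subst h
        refine ae_of_all _ fun ω => ?_
        have hω : X.estimate π t ω = f (X.history π t ω) := congrFun hfe ω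
        rw [control, hhist t le_rfl, hr', hω]
        rfl
      · filter_upwards [hce t (by omega)] with ω hω
        rw [← hω, control, control, hlt t h, hhist t (by omega)]

/-! ### Square-integrability of the controls -/

lemma memLp_control_of_isCertaintyEquivalent (hce : X.IsCertaintyEquivalent π)
    (ht : t < D.T) : MemLp (X.control π t) 2 μ := by
  induction t using Nat.strong_induction_on with
  | _ t ih =>
    have hx := X.memLp_state ht.le fun s hs => ih s hs (by omega)
    refine (memLp_congr_ae (hce t ht)).mpr ?_
    exact memLp_matCLM (D.gainK t) (hx.condExp one_le_two)

lemma memLp_control_of_cost_ne_top (hπ : Admissible π) (h : X.cost π ≠ ∞) (ht : t < D.T) :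
    MemLp (X.control π t) 2 μ := by
  have hu : Measurable (X.control π t) :=
    X.measurable_control hπ ht (X.measurable_history_of_lt hπ ht)
  refine memLp_two_of_lintegral_quadForm (D.R_posDef t ht) hu ?_
  refine ne_top_of_le_ne_top (ENNReal.sum_ne_top.mp h t (Finset.mem_range.mpr ht))
    (lintegral_mono fun ω => ENNReal.ofReal_le_ofReal ?_)
  exact le_add_of_nonneg_left (quadForm_nonneg (D.Q_posSemidef t ht) _)

/-! ### The cost as optimal value plus deviation from certainty equivalence -/

/-- The expected cost-to-go decreases by the running cost, up to the deviation of the control from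
`K x̂` and the contributions of the estimation error and of the process noise. -/
lemma integral_runningCost [IsProbabilityMeasure μ] (hπ : Admissible π) (ht : t < D.T)
    (hx : MemLp (X.state π t) 2 μ)
    (hu : MemLp (X.control π t) 2 μ) :
    ∫ ω, (quadForm (D.Q t) (X.state π (t + 1) ω) + quadForm (D.R t) (X.control π t ω)) ∂μ =
      (∫ ω, quadForm (D.riccatiN t) (X.state π t ω) ∂μ -
        ∫ ω, quadForm (D.riccatiN (t + 1)) (X.state π (t + 1) ω) ∂μ) +
      (∫ ω, quadForm (D.riccatiM t)
          (X.control π t ω - matCLM (D.gainK t) (X.estimate π t ω)) ∂μ +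
        ((D.theta t * X.errorCovOf π t).trace + (D.covW t * D.riccatiS t).trace)) := by
  have hSt := transpose_eq_of_posSemidef (riccatiS_posSemidef ht)
  have hMt := transpose_eq_of_posSemidef (riccatiM_posDef ht).posSemidef
  have hw := X.memLp_w ht
  have hp : MemLp (fun ω => matCLM (D.A t) (X.state π t ω) +
      matCLM (D.B t) (X.control π t ω)) 2 μ :=
    (memLp_matCLM _ hx).add (memLp_matCLM _ hu)
  have hx' : MemLp (X.state π (t + 1)) 2 μ := by
    rw [funext (X.state_succ π t)]
    exact hp.add hw
  have hd : MemLp (fun ω => X.control π t ω - matCLM (D.gainK t) (X.state π t ω)) 2 μ :=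
    hu.sub (memLp_matCLM _ hx)
  have hpoint (ω : Ω) :
      quadForm (D.Q t) (X.state π (t + 1) ω) + quadForm (D.R t) (X.control π t ω) =
        quadForm (D.riccatiN t) (X.state π t ω) -
          quadForm (D.riccatiN (t + 1)) (X.state π (t + 1) ω) +
        quadForm (D.riccatiM t) (X.control π t ω - matCLM (D.gainK t) (X.state π t ω)) +
        quadForm (D.riccatiS t) (X.w t ω) +
        2 * inner ℝ (matCLM (D.A t) (X.state π t ω) + matCLM (D.B t) (X.control π t ω))
          (matCLM (D.riccatiS t) (X.w t ω)) := by
    have h1 := quadForm_step ht (X.state π t ω) (X.control π t ω)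
    have h2 := quadForm_add_matrix (D.Q t) (D.riccatiN (t + 1)) (X.state π (t + 1) ω)
    have h3 := quadForm_add hSt
      (matCLM (D.A t) (X.state π t ω) + matCLM (D.B t) (X.control π t ω)) (X.w t ω)
    rw [← state_succ] at h3
    have h4 : quadForm (D.riccatiS t) (X.state π (t + 1) ω) =
      quadForm (D.Q t + D.riccatiN (t + 1)) (X.state π (t + 1) ω) := rfl
    linarith
  have hcross : ∫ ω, inner ℝ (matCLM (D.A t) (X.state π t ω) + matCLM (D.B t) (X.control π t ω))
      (matCLM (D.riccatiS t) (X.w t ω)) ∂μ = 0 := by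
    refine integral_inner_eq_zero_of_condExp (X.past_le t) hp ?_ (memLp_matCLM _ hw) ?_
    · exact (((matCLM (D.A t)).measurable.comp (X.measurable_past_state hπ ht le_rfl)).add
        ((matCLM (D.B t)).measurable.comp
          (X.measurable_past_control hπ ht))).stronglyMeasurable.aestronglyMeasurable
    · refine ((matCLM (D.riccatiS t)).comp_condExp_comm (hw.integrable one_le_two)).symm.trans ?_
      filter_upwards [X.condExp_past_w ht] with ω hω
      simp [hω]
  have hsplit := integral_quadForm_sub_condExp (X.info_le hπ ht) hMt (D.gainK t) hx hu
    (X.measurable_control_info hπ ht).stronglyMeasurable.aestronglyMeasurable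
  have herr : MemLp (X.estimate π t - X.state π t) 2 μ := (hx.condExp one_le_two).sub hx
  have htr : ∫ ω, quadForm (D.theta t) ((X.estimate π t - X.state π t) ω) ∂μ =
      (D.theta t * X.errorCovOf π t).trace := integral_quadForm _ herr
  have hnoise := integral_quadForm_of_map_eq_multivariateGaussian (X.measurable_w t ht)
    (D.covW_posSemidef t ht) (X.law_w t ht) (D.riccatiS t)
  have i1 := integrable_quadForm (D.riccatiN t) hx
  have i2 := integrable_quadForm (D.riccatiN (t + 1)) hx'
  have i3 := integrable_quadForm (D.riccatiM t) hd
  have i4 := integrable_quadForm (D.riccatiS t) hw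
  have i5 := (integrable_inner_matCLM (D.riccatiS t) hp hw).const_mul 2
  have i12 : Integrable (fun ω => quadForm (D.riccatiN t) (X.state π t ω) -
      quadForm (D.riccatiN (t + 1)) (X.state π (t + 1) ω)) μ := i1.sub i2
  simp only [hpoint]
  rw [integral_add ((i12.fun_add i3).fun_add i4) i5, integral_add (i12.fun_add i3) i4,
    integral_add i12 i3, integral_sub i1 i2, integral_const_mul, hcross, hsplit, hnoise]
  have htr' : ∫ ω, quadForm ((D.gainK t)ᵀ * D.riccatiM t * D.gainK t)
      ((μ[X.state π t | X.info π t] - X.state π t) ω) ∂μ =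
      (D.theta t * X.errorCovOf π t).trace := htr
  rw [htr']
  simp only [estimate]
  ring

/-- The optimal value `g(S)` of the control problem with active sensors `S`. -/
noncomputable def optimalValue (S : Finset V) : ℝ :=
  (∫ ω, quadForm (D.riccatiN 0) (X.x₀ ω) ∂μ) +
    ∑ t ∈ Finset.range D.T,
      ((D.theta t * X.errorCov S t).trace + (D.covW t * D.riccatiS t).trace)

/-- The mean square deviation of the controls of `π` from certainty equivalence. -/
noncomputable def deviation (π : D.Policy S) : ℝ :=
  ∑ t ∈ Finset.range D.T, ∫ ω, quadForm (D.riccatiM t)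
    (X.control π t ω - matCLM (D.gainK t) (X.estimate π t ω)) ∂μ

lemma sum_integral_runningCost [IsProbabilityMeasure μ] (hπ : Admissible π)
    (hu : ∀ t < D.T, MemLp (X.control π t) 2 μ) :
    ∑ t ∈ Finset.range D.T,
      ∫ ω, (quadForm (D.Q t) (X.state π (t + 1) ω) + quadForm (D.R t) (X.control π t ω)) ∂μ =
    X.optimalValue S + X.deviation π := by
  have h : ∀ t ∈ Finset.range D.T, _ = _ := fun t ht =>
    have ht := Finset.mem_range.mp ht
    X.integral_runningCost hπ ht (X.memLp_state ht.le fun s hs => hu s (by omega)) (hu t ht)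
  have herr : ∀ t ∈ Finset.range D.T, (D.theta t * X.errorCovOf π t).trace +
      (D.covW t * D.riccatiS t).trace =
      (D.theta t * X.errorCov S t).trace + (D.covW t * D.riccatiS t).trace := fun t ht => by
    have ht := Finset.mem_range.mp ht
    rw [X.errorCovOf_eq_errorCov hπ ht fun s hs => hu s (by omega)]
  rw [Finset.sum_congr rfl h, Finset.sum_add_distrib, Finset.sum_add_distrib,
    Finset.sum_congr rfl herr,
    Finset.sum_range_sub' fun t => ∫ ω, quadForm (D.riccatiN t) (X.state π t ω) ∂μ]
  have h0 : ∫ ω, quadForm (D.riccatiN D.T) (X.state π D.T ω) ∂μ = 0 := by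
    simp [D.riccatiN_of_le le_rfl, quadForm]
  simp only [h0, state_zero, optimalValue, deviation]
  ring

lemma cost_eq [IsProbabilityMeasure μ] (hπ : Admissible π)
    (hu : ∀ t < D.T, MemLp (X.control π t) 2 μ) :
    X.cost π = ENNReal.ofReal (X.optimalValue S + X.deviation π) := by
  have hnn (t : ℕ) (ht : t < D.T) (ω : Ω) :
      0 ≤ quadForm (D.Q t) (X.state π (t + 1) ω) + quadForm (D.R t) (X.control π t ω) :=
    add_nonneg (quadForm_nonneg (D.Q_posSemidef t ht) _)
      (quadForm_nonneg (D.R_posDef t ht).posSemidef _)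
  rw [← X.sum_integral_runningCost hπ hu, ENNReal.ofReal_sum_of_nonneg fun t ht =>
    integral_nonneg (hnn t (Finset.mem_range.mp ht))]
  refine Finset.sum_congr rfl fun t ht => ?_
  have ht := Finset.mem_range.mp ht
  refine (ofReal_integral_eq_lintegral_ofReal ?_ (ae_of_all _ (hnn t ht))).symm
  exact (integrable_quadForm _ (X.memLp_state ht fun s hs => hu s (by omega))).add
    (integrable_quadForm _ (hu t ht))

lemma deviation_nonneg (π : D.Policy S) : 0 ≤ X.deviation π :=
  Finset.sum_nonneg fun _ ht => integral_nonneg fun _ =>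
    quadForm_nonneg (riccatiM_posDef (Finset.mem_range.mp ht)).posSemidef _

lemma deviation_eq_zero_iff [IsProbabilityMeasure μ] (hu : ∀ t < D.T, MemLp (X.control π t) 2 μ) :
    X.deviation π = 0 ↔ X.IsCertaintyEquivalent π := by
  have hnn (t : ℕ) (ht : t < D.T) (ω : Ω) : 0 ≤ quadForm (D.riccatiM t)
      (X.control π t ω - matCLM (D.gainK t) (X.estimate π t ω)) :=
    quadForm_nonneg (riccatiM_posDef ht).posSemidef _
  rw [deviation, Finset.sum_eq_zero_iff_of_nonneg fun t ht =>
    integral_nonneg (hnn t (Finset.mem_range.mp ht))]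
  simp only [Finset.mem_range, IsCertaintyEquivalent]
  refine forall₂_congr fun t ht => ?_
  have hx := X.memLp_state ht.le fun s hs => hu s (by omega)
  have hi := integrable_quadForm (D.riccatiM t)
    ((hu t ht).sub (memLp_matCLM (D.gainK t) (hx.condExp (m := X.info π t) one_le_two)))
  refine (integral_eq_zero_iff_of_nonneg (hnn t ht) hi).trans ?_
  refine Filter.eventually_congr (ae_of_all _ fun ω => ⟨fun h => ?_, fun h => ?_⟩)
  · exact sub_eq_zero.mp (eq_zero_of_quadForm_eq_zero (riccatiM_posDef ht) h)
  · have h' : X.control π t ω - matCLM (D.gainK t) (X.estimate π t ω) = 0 := sub_eq_zero.mpr h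
    simp [h', quadForm]

lemma cost_eq_of_isCertaintyEquivalent [IsProbabilityMeasure μ] (hπ : Admissible π)
    (hce : X.IsCertaintyEquivalent π) :
    X.cost π = ENNReal.ofReal (X.optimalValue S) := by
  have hu := fun t ht => X.memLp_control_of_isCertaintyEquivalent (t := t) hce ht
  rw [X.cost_eq hπ hu, (X.deviation_eq_zero_iff hu).mpr hce, add_zero]

lemma optimalValue_nonneg [IsProbabilityMeasure μ] (S : Finset V) : 0 ≤ X.optimalValue S := by
  obtain ⟨π, hπ, hce⟩ := X.exists_isCertaintyEquivalent S
  have hu := fun t ht => X.memLp_control_of_isCertaintyEquivalent (t := t) hce ht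
  have h := X.sum_integral_runningCost hπ hu
  rw [(X.deviation_eq_zero_iff hu).mpr hce, add_zero] at h
  rw [← h]
  exact Finset.sum_nonneg fun t ht => integral_nonneg fun ω =>
    add_nonneg (quadForm_nonneg (D.Q_posSemidef t (Finset.mem_range.mp ht)) _)
      (quadForm_nonneg (D.R_posDef t (Finset.mem_range.mp ht)).posSemidef _)

lemma optimalValue_le_cost [IsProbabilityMeasure μ] (hπ : Admissible π) :
    ENNReal.ofReal (X.optimalValue S) ≤ X.cost π := by
  by_cases h : X.cost π = ∞
  · simp [h]
  · rw [X.cost_eq hπ fun t ht => X.memLp_control_of_cost_ne_top hπ h ht]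
    exact ENNReal.ofReal_le_ofReal (le_add_of_nonneg_right (X.deviation_nonneg π))

/-- A policy that attains the optimal value has no deviation from certainty equivalence. -/
lemma isCertaintyEquivalent_of_cost_le [IsProbabilityMeasure μ] (hπ : Admissible π)
    (h : X.cost π ≤ ENNReal.ofReal (X.optimalValue S)) : X.IsCertaintyEquivalent π := by
  have hu := fun t ht => X.memLp_control_of_cost_ne_top (t := t) hπ
    (ne_top_of_le_ne_top ENNReal.ofReal_ne_top h) ht
  rw [X.cost_eq hπ hu, ENNReal.ofReal_le_ofReal_iff (X.optimalValue_nonneg S)] at h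
  exact (X.deviation_eq_zero_iff hu).mp (le_antisymm (by linarith) (X.deviation_nonneg π))

/-! ### Optimal policies and optimal sensor sets -/

lemma isOptimalPolicy_iff [IsProbabilityMeasure μ] (hπ : Admissible π) :
    X.IsOptimalPolicy π ↔ X.IsCertaintyEquivalent π := by
  refine ⟨fun h => ?_, fun h => ⟨hπ, fun π' hπ' => ?_⟩⟩
  · obtain ⟨π', hπ', hce⟩ := X.exists_isCertaintyEquivalent S
    refine X.isCertaintyEquivalent_of_cost_le hπ ?_
    rw [← X.cost_eq_of_isCertaintyEquivalent hπ' hce]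
    exact h.2 π' hπ'
  · rw [X.cost_eq_of_isCertaintyEquivalent hπ h]
    exact X.optimalValue_le_cost hπ'

/-- The optimal value and the sensing objective differ by a term that no sensor set affects. -/
lemma optimalValue_le_optimalValue_iff (S S' : Finset V) :
    X.optimalValue S ≤ X.optimalValue S' ↔ X.sensingCost S ≤ X.sensingCost S' := by
  simp only [optimalValue, sensingCost, Finset.sum_add_distrib]
  constructor <;> intro h <;> linarith

lemma isSolution_iff [IsProbabilityMeasure μ] (k : ℕ) (hπ : Admissible π) :
    X.IsSolution k S π ↔ X.IsOptimalSensorSet k S ∧ X.IsCertaintyEquivalent π := by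
  constructor
  · rintro ⟨hk, -, hmin⟩
    have hce : X.IsCertaintyEquivalent π :=
      (X.isOptimalPolicy_iff hπ).mp ⟨hπ, fun π' hπ' => hmin S π' hk hπ'⟩
    refine ⟨⟨hk, fun S' hk' => ?_⟩, hce⟩
    obtain ⟨π', hπ', hce'⟩ := X.exists_isCertaintyEquivalent S'
    have h := hmin S' π' hk' hπ'
    rwa [X.cost_eq_of_isCertaintyEquivalent hπ hce, X.cost_eq_of_isCertaintyEquivalent hπ' hce',
      ENNReal.ofReal_le_ofReal_iff (X.optimalValue_nonneg S'),
      optimalValue_le_optimalValue_iff] at h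
  · rintro ⟨⟨hk, hmin⟩, hce⟩
    refine ⟨hk, hπ, fun S' π' hk' hπ' => ?_⟩
    rw [X.cost_eq_of_isCertaintyEquivalent hπ hce]
    refine le_trans (ENNReal.ofReal_le_ofReal ?_) (X.optimalValue_le_cost hπ')
    exact (X.optimalValue_le_optimalValue_iff S S').mpr (hmin S' hk')

lemma exists_isOptimalSensorSet [Finite V] (k : ℕ) : ∃ S, X.IsOptimalSensorSet k S := by
  obtain ⟨S, hS, hmin⟩ := Set.exists_min_image {S : Finset V | S.card ≤ k} X.sensingCost
    (Set.toFinite _) ⟨∅, by simp⟩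
  exact ⟨S, hS, hmin⟩

lemma exists_isSolution [IsProbabilityMeasure μ] [Finite V] (k : ℕ) :
    ∃ (S : Finset V) (π : D.Policy S), X.IsSolution k S π := by
  obtain ⟨S, hS⟩ := X.exists_isOptimalSensorSet k
  obtain ⟨π, hπ, hce⟩ := X.exists_isCertaintyEquivalent S
  exact ⟨S, π, (X.isSolution_iff k hπ).mpr ⟨hS, hce⟩⟩

end Randomness

end LQGData

theorem mainTheorem1 {V : Type*} [Finite V] (D : LQGData V)
    {Ω : Type*} [MeasurableSpace Ω] (μ : Measure Ω) [IsProbabilityMeasure μ]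
    (X : D.Randomness μ) :
    -- the solutions of the joint problem are exactly the cascaded designs, and they exist
    (∀ k : ℕ,
      (∀ (S : Finset V) (π : D.Policy S), LQGData.Admissible π →
        (X.IsSolution k S π ↔ X.IsOptimalSensorSet k S ∧ X.IsCertaintyEquivalent π)) ∧
      ∃ (S : Finset V) (π : D.Policy S), X.IsSolution k S π) ∧
    -- for each fixed sensor set: optimal controllers and optimal value
    (∀ S : Finset V,
      (∃ π : D.Policy S, LQGData.Admissible π ∧ X.IsCertaintyEquivalent π) ∧
      ∀ π : D.Policy S, LQGData.Admissible π →
        (X.IsOptimalPolicy π ↔ X.IsCertaintyEquivalent π) ∧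
        (X.IsCertaintyEquivalent π →
          X.cost π = ENNReal.ofReal
            ((∫ ω, quadForm (D.riccatiN 0) (X.x₀ ω) ∂μ) +
              ∑ t ∈ Finset.range D.T,
                ((D.theta t * X.errorCov S t).trace +
                  (D.covW t * D.riccatiS t).trace)))) ∧
    -- the error covariance depends on the sensor set only, not on the policy in force
    (∀ (S : Finset V) (π : D.Policy S), LQGData.Admissible π → X.cost π ≠ ∞ →
      ∀ t < D.T, X.errorCovOf π t = X.errorCov S t) ∧
    -- the recursion for `N` in its form with `S⁻¹`
    (∀ t < D.T, IsUnit (D.riccatiS t) →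
      D.riccatiN t =
        (D.A t)ᵀ * ((D.riccatiS t)⁻¹ + D.B t * (D.R t)⁻¹ * (D.B t)ᵀ)⁻¹ * D.A t) := by
  refine ⟨fun k => ⟨fun S π hπ => X.isSolution_iff k hπ, X.exists_isSolution k⟩,
    fun S => ⟨X.exists_isCertaintyEquivalent S, fun π hπ =>
      ⟨X.isOptimalPolicy_iff hπ, fun hce => X.cost_eq_of_isCertaintyEquivalent hπ hce⟩⟩,
    fun S π hπ h t ht => X.errorCovOf_eq_errorCov hπ ht fun s hs =>
      X.memLp_control_of_cost_ne_top hπ h (hs.trans ht),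
    fun t ht hS => LQGData.riccatiN_eq_of_isUnit ht hS⟩
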